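/- Let $k$ be an algebraic closure of a finite field of characteristic $p$ and let $\ell \neq p$ be a prime. Let $K = k((t))$, let $I = \mathrm{Gal}(K^{\mathrm{sep}}/K)$ be its absolute Galois group with the Krull topology (the inertia group), and let $P = \mathrm{Gal}(K^{\mathrm{sep}}/K^{\mathrm{tame}}) \subset I$ be the wild inertia subgroup, where $K^{\mathrm{tame}} \subset K^{\mathrm{sep}}$ is the maximal tamely ramified extension of $K$. Let $V$ be a finite-dimensional $\overline{\mathbb{Q}}_\ell$-vector space and let $\rho : I \to \mathrm{GL}(V)$ be an irreducible representation that is continuous for the $\ell$-adic topology. Then there is a continuous character $\chi : I \to \overline{\mathbb{Q}}_\ell^{*}$, trivial on $P$, such that $\rho \otimes \chi$ has finite image. -/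

import Mathlib

open scoped PowerSeries LaurentSeries

noncomputable section

namespace LocalMonodromy

/-! ### The inertia group of `K = k((t))` and its wild part -/

/-- The separable closure `K^sep` of the field `K = k((t))` of formal Laurent series. -/
abbrev KSep (k : Type*) [Field k] : Type _ := SeparableClosure k⸨X⸩

/-- The inertia group `I = Gal(K^sep / K)`, the absolute Galois group of `K = k((t))`, with its
Krull topology. -/
abbrev Inertia (k : Type*) [Field k] : Type _ := Gal(KSep k/k⸨X⸩)

/-- The subextension `E` of `K^sep / K` is finite and tamely ramified: with `O_E` the integral
closure of `k[[t]]` in `E`, at every maximal ideal of `O_E` above the maximal ideal of `k[[t]]`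
the ramification index is prime to `p` and the residue field extension is separable. Here `p` is
meant to be the characteristic of `k`. -/
def IsFiniteTame (p : ℕ) {k : Type*} [Field k] (E : IntermediateField k⸨X⸩ (KSep k)) : Prop :=
  FiniteDimensional k⸨X⸩ E ∧
    ∀ (𝔓 : Ideal (integralClosure k⟦X⟧ E)) [𝔓.IsMaximal]
      [𝔓.LiesOver (IsLocalRing.maximalIdeal k⟦X⟧)],
      Nat.Coprime p (𝔓.ramificationIdx k⟦X⟧) ∧
        Algebra.IsSeparable (k⟦X⟧ ⧸ IsLocalRing.maximalIdeal k⟦X⟧)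
          (integralClosure k⟦X⟧ E ⧸ 𝔓)

/-- The maximal tamely ramified extension `K^tame` of `K` inside `K^sep`: the compositum of all
finite tamely ramified subextensions. -/
def KTame (p : ℕ) (k : Type*) [Field k] : IntermediateField k⸨X⸩ (KSep k) :=
  ⨆ (E : IntermediateField k⸨X⸩ (KSep k)) (_ : IsFiniteTame p E), E

/-- The wild inertia group `P = Gal(K^sep / K^tame)`, as a subgroup of `I`. -/
def wildInertia (p : ℕ) (k : Type*) [Field k] : Subgroup (Inertia k) :=
  (KTame p k).fixingSubgroup

/-! ### Continuous representations -/

/-- A representation `ρ` of a topological group on a vector space `V` over a topological field is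
continuous if all its matrix coefficients `g ↦ f (ρ g v)` are continuous. For `V` of finite
dimension `n` this says that the homomorphism to `GL(V) ≅ GL_n` is continuous. -/
def IsContinuousRep {𝕜 G V : Type*} [Field 𝕜] [TopologicalSpace 𝕜] [Group G] [TopologicalSpace G]
    [AddCommGroup V] [Module 𝕜 V] (ρ : Representation 𝕜 G V) : Prop :=
  ∀ (v : V) (f : Module.Dual 𝕜 V), Continuous fun g : G => f (ρ g v)

/-- The one-dimensional representation attached to a character `χ : G → 𝕜ˣ`. -/
def ofCharacter {𝕜 G : Type*} [Field 𝕜] [Group G] (χ : G →* 𝕜ˣ) : Representation 𝕜 G 𝕜 where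
  toFun g := (χ g : 𝕜) • LinearMap.id
  map_one' := by
    ext
    simp
  map_mul' g h := by
    ext
    simp [mul_comm]

end LocalMonodromy

end

/-!
The argument is Grothendieck's: only the pro-`ℓ` part of tame inertia can act with infinite image,
and it is made to act through roots of unity by a twist.

Choose a compatible system `τ n` of `ℓ ^ n`-th roots of `t` in `K^sep`, and let `N ⊆ I` be the
subgroup fixing all of them. Three facts about `N` are needed.

* `N` contains the wild inertia group, since every `K(τ n)` is Galois over `K` of degree a power of
  `ℓ`, hence tame (`IsRootTower.wildInertia_le`).
* `N` is prime to `ℓ`: every neighbourhood of `1` contains a power of `g ∈ N` with exponent prime to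
  `ℓ` (`IsRootTower.exists_coprime_pow_mem`). The reason is that every element of the fixed field
  of `g` is an `ℓ`-th power there (`IsRootTower.exists_fixed_root`): after dividing by
  `ℓ`-power roots of `t` it becomes a unit, and units are `ℓ`-th powers because the residue field
  `k` is algebraically closed and `ℓ` is invertible in it. By Kummer theory `g` and `g ^ ℓ` then
  have the same fixed field.
* `I / N` is pro-`ℓ` and procyclic, generated by any `g` that moves `τ 1` (`IsProcyclicTower`).

For the representation, a prime-to-`ℓ` element acting by a matrix congruent to `1` acts trivially,
because `‖A ^ n - 1‖ = ‖A - 1‖` when `‖A - 1‖ < 1` and `ℓ ∤ n`. So `ρ` is trivial on `N ∩ U` for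
some open normal subgroup `U`, the group `ρ(N)` is finite, and for `g ^ M ∈ U` the operator `ρ (g ^ M)`
commutes with `ρ(N)` and with `ρ g`, hence with everything. By Schur's lemma it is a scalar `c`, and
`‖c - 1‖ < 1`. Pick `a` with `a ^ M = c⁻¹` and `‖a - 1‖ < 1`; since `a ^ ℓ ^ n → 1`, there is a
continuous character `χ` of `I / N` with `χ g = a` (`IsProcyclicTower.exists_character`). The twist
by `χ` sends `g` to an operator of finite order and is finite on `N`, so it has finite image
(`IsProcyclicTower.exists_twist_finite`).
-/

noncomputable section

namespace LocalMonodromy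

/-! ### The norm on the separable closure of `k((t))` -/

/-- The `t`-adic valuation on `k((t))` as a rank one valuation, normalised so that `t` has norm
`1 / 2`. -/
instance laurentRankOne (k : Type*) [Field k] :
    Valuation.RankOne (Valued.v : Valuation k⸨X⸩ (WithZero (Multiplicative ℤ))) where
  hom' := (WithZeroMulInt.toNNReal (e := 2) two_ne_zero).comp
    MonoidWithZeroHom.ValueGroup₀.embedding
  strictMono' := (WithZeroMulInt.toNNReal_strictMono (by norm_num)).comp
    MonoidWithZeroHom.ValueGroup₀.embedding_strictMono
  exists_val_nontrivial := by
    obtain ⟨x, hx⟩ := LaurentSeries.valuation_surjective k (WithZero.exp (1 : ℤ))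
    exact ⟨x, by simp [hx], by rw [hx]; decide⟩

open scoped Valued

variable (k : Type*) [Field k]

lemma laurent_norm_eq (f : k⸨X⸩) :
    ‖f‖ = WithZeroMulInt.toNNReal (e := 2) two_ne_zero (Valued.v f) := by
  change ((WithZeroMulInt.toNNReal (e := 2) two_ne_zero
    (MonoidWithZeroHom.ValueGroup₀.embedding (Valued.v.restrict f)) : NNReal) : ℝ) = _
  congr 2
  exact MonoidWithZeroHom.ValueGroup₀.embedding_restrict₀ f

lemma laurent_norm_C {c : k} (hc : c ≠ 0) : ‖(HahnSeries.C c : k⸨X⸩)‖ = 1 := by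
  have key : ∀ c : k, ‖(HahnSeries.C c : k⸨X⸩)‖ ≤ 1 := by
    intro c
    rw [Valued.toNormedField.norm_le_one_iff, LaurentSeries.val_le_one_iff_eq_coe]
    exact ⟨PowerSeries.C c, by simp⟩
  have h := key c⁻¹
  rw [map_inv₀, norm_inv] at h
  refine le_antisymm (key c) ?_
  have h0 : 0 < ‖(HahnSeries.C c : k⸨X⸩)‖ := by simpa using hc
  exact (inv_le_one₀ h0).1 h

/-- The parameter `t` of `K = k((t))`. -/
def uniformizer : k⸨X⸩ := HahnSeries.single 1 1

lemma toNNReal_exp (n : ℤ) :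
    WithZeroMulInt.toNNReal (e := 2) two_ne_zero (WithZero.exp n) = 2 ^ n := by
  rw [WithZeroMulInt.toNNReal_neg_apply _ WithZero.exp_ne_zero]
  rfl

lemma laurent_norm_uniformizer : ‖uniformizer k‖ = 2⁻¹ := by
  rw [laurent_norm_eq, uniformizer, LaurentSeries.valuation_single_zpow, toNNReal_exp]
  simp

lemma laurent_norm_zpow {f : k⸨X⸩} (hf : f ≠ 0) : ∃ n : ℤ, ‖f‖ = ‖uniformizer k‖ ^ n := by
  have : Valued.v f ≠ 0 := by simpa using hf
  refine ⟨-WithZero.log (Valued.v f), ?_⟩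
  rw [laurent_norm_uniformizer, laurent_norm_eq, ← WithZero.exp_log this,
    toNNReal_exp]
  simp

lemma laurent_sub_C {f : k⸨X⸩} (hf : ‖f‖ ≤ 1) :
    ∃ c : k, ‖f - HahnSeries.C c‖ < 1 := by
  rw [Valued.toNormedField.norm_le_one_iff, LaurentSeries.val_le_one_iff_eq_coe] at hf
  obtain ⟨F, rfl⟩ := hf
  refine ⟨PowerSeries.constantCoeff F, ?_⟩
  obtain ⟨G, hG⟩ := PowerSeries.X_dvd_iff.2
    (show PowerSeries.constantCoeff (F - PowerSeries.C (PowerSeries.constantCoeff F)) = 0 by simp)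
  have : ((F : k⟦X⟧) : k⸨X⸩) - HahnSeries.C (PowerSeries.constantCoeff F)
      = uniformizer k * (G : k⸨X⸩) := by
    have := congrArg (fun H : k⟦X⟧ => (H : k⸨X⸩)) hG
    simpa [uniformizer] using this
  rw [this, norm_mul, laurent_norm_uniformizer]
  have : ‖(G : k⸨X⸩)‖ ≤ 1 := by
    rw [Valued.toNormedField.norm_le_one_iff, LaurentSeries.val_le_one_iff_eq_coe]
    exact ⟨G, rfl⟩
  linarith

/-- The inclusion of the constant field `k` in `K^sep`. -/
def constSep : k →+* KSep k := (algebraMap k⸨X⸩ (KSep k)).comp HahnSeries.C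

/-- The parameter `t` viewed in `K^sep`. -/
def uniformizerSep : KSep k := algebraMap k⸨X⸩ (KSep k) (uniformizer k)

/-- The unique extension of the `t`-adic norm to `K^sep`, given by the spectral norm. It is kept as
a function and not as a norm instance on `K^sep`. -/
def sepNorm : MulAlgebraNorm k⸨X⸩ (KSep k) := spectralMulAlgNorm k⸨X⸩ (KSep k)

variable {k}

lemma sepNorm_algebraMap (f : k⸨X⸩) : sepNorm k (algebraMap _ _ f) = ‖f‖ :=
  spectralNorm_extends f

lemma sepNorm_add_le (x y : KSep k) : sepNorm k (x + y) ≤ max (sepNorm k x) (sepNorm k y) :=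
  isNonarchimedean_spectralNorm x y

lemma sepNorm_galois (σ : Inertia k) (x : KSep k) : sepNorm k (σ x) = sepNorm k x :=
  (spectralNorm_eq_of_equiv σ x).symm

lemma sepNorm_const {c : k} (hc : c ≠ 0) : sepNorm k (constSep k c) = 1 := by
  rw [constSep, RingHom.comp_apply, sepNorm_algebraMap, laurent_norm_C k hc]

lemma sepNorm_uniformizerSep : sepNorm k (uniformizerSep k) = 2⁻¹ := by
  rw [uniformizerSep, sepNorm_algebraMap, laurent_norm_uniformizer]

/-- The value group of `K^sep` is contained in `|t| ^ ℚ`. -/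
lemma sepNorm_pow_eq {x : KSep k} (hx : x ≠ 0) :
    ∃ m : ℕ, 0 < m ∧ ∃ a : ℤ, sepNorm k x ^ m = sepNorm k (uniformizerSep k) ^ a := by
  have hint : IsIntegral k⸨X⸩ x := Algebra.IsIntegral.isIntegral x
  refine ⟨(minpoly k⸨X⸩ x).natDegree, minpoly.natDegree_pos hint, ?_⟩
  obtain ⟨n, hn⟩ := laurent_norm_zpow k (minpoly.coeff_zero_ne_zero hint hx)
  refine ⟨n, ?_⟩
  have := spectralNorm.spectralNorm_eq_norm_coeff_zero_rpow (K := k⸨X⸩) (L := KSep k) x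
  rw [uniformizerSep, sepNorm_algebraMap, ← hn]
  change spectralNorm _ _ x ^ _ = _
  rw [this, one_div, Real.rpow_inv_natCast_pow (norm_nonneg _)
    (minpoly.natDegree_pos hint).ne']

/-- A point at which a polynomial over `k` is small is close to one of its roots in `k`. -/
lemma exists_root_norm_sub_lt_one [IsAlgClosed k] {f : Polynomial k} (hf : f ≠ 0) {x : KSep k}
    (hx : sepNorm k (f.eval₂ (constSep k) x) < 1) :
    ∃ r ∈ f.roots, sepNorm k (x - constSep k r) < 1 := by
  by_contra! hcon
  refine absurd hx (not_lt.2 ?_)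
  rw [(IsAlgClosed.splits f).eq_prod_roots, Polynomial.eval₂_mul, Polynomial.eval₂_C, map_mul,
    sepNorm_const (Polynomial.leadingCoeff_ne_zero.2 hf), one_mul]
  generalize f.roots = s at hcon ⊢
  induction s using Multiset.induction with
  | empty => simp
  | cons a s ih =>
    rw [Multiset.map_cons, Multiset.prod_cons, Polynomial.eval₂_mul, map_mul]
    exact one_le_mul_of_one_le_of_one_le (by simpa using hcon a (Multiset.mem_cons_self a s))
      (ih fun r hr => hcon r (Multiset.mem_cons_of_mem hr))

/-- The residue field of `K^sep` is `k`: the reduction modulo `t` of the minimal polynomial of an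
integral element `x` is small at `x`, so one of its roots is close to `x`. -/
lemma exists_norm_sub_const_lt_one [IsAlgClosed k] {x : KSep k} (hx : sepNorm k x ≤ 1) :
    ∃ c : k, sepNorm k (x - constSep k c) < 1 := by
  have hint : IsIntegral k⸨X⸩ x := Algebra.IsIntegral.isIntegral x
  set f := minpoly k⸨X⸩ x with hf
  have hcoeff : ∀ i, ‖f.coeff i‖ ≤ 1 := (spectralValue_le_one_iff (minpoly.monic hint)).1 hx
  choose c hc using fun i => laurent_sub_C k (hcoeff i)
  set d := f.natDegree with hd
  -- the coefficientwise reduction of the minimal polynomial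
  let f₀ : Polynomial k := ∑ i ∈ Finset.range (d + 1), Polynomial.monomial i (c i)
  have hf₀ : f₀ ≠ 0 := by
    intro h
    have h1 : f₀.coeff d = c d := by
      simp [f₀, Polynomial.finsetSum_coeff, Polynomial.coeff_monomial]
    rw [h, Polynomial.coeff_zero] at h1
    have := hc d
    rw [← h1, map_zero, sub_zero, hd, Polynomial.coeff_natDegree,
      (minpoly.monic hint).leadingCoeff, norm_one] at this
    exact lt_irrefl _ this
  have heval : f₀.eval₂ (constSep k) x
      = ∑ i ∈ Finset.range (d + 1), algebraMap _ _ (HahnSeries.C (c i) - f.coeff i) * x ^ i := by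
    have h0 : ∑ i ∈ Finset.range (d + 1), algebraMap _ (KSep k) (f.coeff i) * x ^ i = 0 := by
      rw [← minpoly.aeval k⸨X⸩ x, Polynomial.aeval_def, Polynomial.eval₂_eq_sum_range]
    simp only [map_sub, sub_mul, Finset.sum_sub_distrib, h0, sub_zero]
    simp [f₀, Polynomial.eval₂_finsetSum, constSep]
  have hlt : sepNorm k (f₀.eval₂ (constSep k) x) < 1 := by
    rw [heval]
    refine Finset.sum_induction _ (fun y => sepNorm k y < 1)
      (fun a b ha hb => (sepNorm_add_le a b).trans_lt (max_lt ha hb)) (by simp) ?_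
    intro i _
    rw [map_mul, map_pow, sepNorm_algebraMap, norm_sub_rev]
    exact mul_lt_one_of_nonneg_of_lt_one_left (norm_nonneg _) (hc i)
      (pow_le_one₀ (apply_nonneg _ _) hx)
  obtain ⟨r, -, hr⟩ := exists_root_norm_sub_lt_one hf₀ hlt
  exact ⟨r, hr⟩

/-! ### The tower of `ℓ`-power roots of the uniformizer -/

lemma galois_const (σ : Inertia k) (c : k) : σ (constSep k c) = constSep k c :=
  σ.commutes _

lemma galois_pow_apply {g : Inertia k} {x : KSep k} {c : k} (hc : g x = constSep k c * x)
    (i : ℕ) : (g ^ i) x = constSep k (c ^ i) * x := by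
  induction i with
  | zero => simp
  | succ i ih =>
    rw [pow_succ', AlgEquiv.mul_apply, ih, map_mul, galois_const, hc, ← mul_assoc, ← map_mul,
      ← pow_succ]

/-- `τ n` is an `ℓ ^ n`-th root of the uniformizer `t`, compatibly in `n`. -/
structure IsRootTower (ℓ : ℕ) (τ : ℕ → KSep k) : Prop where
  zero : τ 0 = uniformizerSep k
  succ_pow (n : ℕ) : τ (n + 1) ^ ℓ = τ n

lemma exists_isRootTower {ℓ : ℕ} (hℓ : (ℓ : k) ≠ 0) : ∃ τ : ℕ → KSep k, IsRootTower ℓ τ := by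
  have : NeZero (ℓ : KSep k) := ⟨by simpa using (map_ne_zero (constSep k)).2 hℓ⟩
  choose f hf using fun x : KSep k => IsSepClosed.exists_pow_nat_eq x ℓ
  exact ⟨fun n => n.rec (uniformizerSep k) fun _ => f, rfl, fun n => hf _⟩

namespace IsRootTower

variable {ℓ : ℕ} {τ : ℕ → KSep k} (hτ : IsRootTower ℓ τ)
include hτ

lemma add_pow (n m : ℕ) : τ (n + m) ^ ℓ ^ m = τ n := by
  induction m with
  | zero => simp
  | succ m ih => rw [pow_succ', pow_mul, ← add_assoc, hτ.succ_pow, ih]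

lemma pow_eq (n : ℕ) : τ n ^ ℓ ^ n = uniformizerSep k := by
  simpa [hτ.zero] using hτ.add_pow 0 n

lemma ne_zero [Fact ℓ.Prime] (n : ℕ) : τ n ≠ 0 := by
  intro h
  have h1 := hτ.pow_eq n
  rw [h, zero_pow (pow_ne_zero _ (Fact.out : ℓ.Prime).ne_zero)] at h1
  have := sepNorm_uniformizerSep (k := k)
  rw [← h1, map_zero] at this
  norm_num at this

lemma stabilizer_antitone : Antitone fun n => MulAction.stabilizer (Inertia k) (τ n) := by
  refine antitone_nat_of_succ_le fun n σ hσ => ?_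
  change σ (τ (n + 1)) = τ (n + 1) at hσ
  change σ (τ n) = τ n
  rw [← hτ.succ_pow, map_pow, hσ]

/-- `t` is not an `ℓ`-th power in `K`, so some automorphism moves `τ 1`. -/
lemma exists_map_one_ne [Fact ℓ.Prime] : ∃ g : Inertia k, g (τ 1) ≠ τ 1 := by
  by_contra! h
  obtain ⟨f, hf⟩ := (InfiniteGalois.mem_range_algebraMap_iff_fixed (k := k⸨X⸩) (τ 1)).2 h
  have h0 : f ≠ 0 := by
    rintro rfl
    exact hτ.ne_zero 1 (by rw [← hf, map_zero])
  obtain ⟨n, hn⟩ := laurent_norm_zpow k h0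
  have h1 := congrArg (sepNorm k) (hτ.pow_eq 1)
  rw [← hf, ← map_pow, uniformizerSep, sepNorm_algebraMap, sepNorm_algebraMap, norm_pow, hn,
    pow_one,
    laurent_norm_uniformizer, ← zpow_natCast, ← zpow_mul] at h1
  have h2 : n * ℓ = 1 :=
    zpow_right_injective₀ (a := (2⁻¹ : ℝ)) (by norm_num) (by norm_num) (by simpa using h1)
  have := Int.le_of_dvd one_pos (Dvd.intro_left n h2)
  have := (Fact.out : ℓ.Prime).two_le
  omega

end IsRootTower

/-! ### Extracting `ℓ`-th roots inside a fixed field -/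

section Roots

open Polynomial

variable [IsAlgClosed k]

/-- All roots of unity of `K^sep` lie in `k`. -/
lemma exists_const_eq_of_pow_eq_one {n : ℕ} (hn : 0 < n) {x : KSep k} (hx : x ^ n = 1) :
    ∃ c : k, c ^ n = 1 ∧ constSep k c = x := by
  have hf : (X ^ n - 1 : k[X]) ≠ 0 := by simpa using X_pow_sub_C_ne_zero hn (1 : k)
  have h0 : ((X ^ n - 1 : k[X]).map (constSep k)).eval x = 0 := by simp [hx]
  have hmem : x ∈ ((X ^ n - 1 : k[X]).map (constSep k)).roots :=
    (mem_roots (Polynomial.map_ne_zero hf)).2 h0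
  rw [(IsAlgClosed.splits (X ^ n - 1 : k[X])).roots_map, Multiset.mem_map] at hmem
  obtain ⟨c, hc, rfl⟩ := hmem
  refine ⟨c, ?_, rfl⟩
  have := (mem_roots'.1 hc).2
  simpa [IsRoot, sub_eq_zero] using this

/-- Krasner's argument: among the `ℓ`-th roots of a one-unit `x` exactly one, `y`, is a one-unit.
Automorphisms preserve the norm, so any `g` fixing `x` fixes `y`. -/
lemma exists_fixed_root_of_norm_sub_one_lt {ℓ : ℕ} (hℓ : (ℓ : k) ≠ 0) (g : Inertia k)
    {x : KSep k} (hgx : g x = x) (hx : sepNorm k (x - 1) < 1) :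
    ∃ y, y ^ ℓ = x ∧ g y = y := by
  have hpos : 0 < ℓ := Nat.pos_of_ne_zero fun h => hℓ (by simp [h])
  have : NeZero (ℓ : KSep k) := ⟨by simpa using (map_ne_zero (constSep k)).2 hℓ⟩
  obtain ⟨z, hz⟩ := IsSepClosed.exists_pow_nat_eq x ℓ
  obtain ⟨r, hr, hzr⟩ := exists_root_norm_sub_lt_one (f := X ^ ℓ - 1) (x := z)
    (by simpa using X_pow_sub_C_ne_zero hpos (1 : k)) (by simpa [hz] using hx)
  have hr1 : r ^ ℓ = 1 := by
    have := (mem_roots'.1 hr).2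
    simpa [IsRoot, sub_eq_zero] using this
  have hr0 : r ≠ 0 := by
    rintro rfl
    simp [hpos.ne'] at hr1
  have hcr : constSep k r ≠ 0 := (_root_.map_ne_zero _).2 hr0
  -- the root of unity `r` is the residue class of `z`, so that `z / r` is a one-unit
  set y := z / constSep k r with hy
  have hyx : y ^ ℓ = x := by rw [hy, div_pow, ← map_pow, hr1, map_one, div_one, hz]
  have hy1 : sepNorm k (y - 1) < 1 := by
    have : z - constSep k r = constSep k r * (y - 1) := by rw [hy]; field_simp
    rwa [this, map_mul, sepNorm_const hr0, one_mul] at hzr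
  have hynorm : 1 ≤ sepNorm k y := by
    by_contra! hlt
    have := sepNorm_add_le (1 - y) y
    rw [sub_add_cancel, map_one, map_sub_rev] at this
    exact absurd this (not_le.2 (max_lt hy1 hlt))
  have hy0 : y ≠ 0 := by
    rintro h
    rw [h, map_zero] at hynorm
    linarith
  obtain ⟨c, hc1, hc⟩ := exists_const_eq_of_pow_eq_one (x := g y / y) hpos (by
    rw [div_pow, ← map_pow, hyx, hgx, div_self]
    rw [← hyx]
    exact pow_ne_zero _ hy0)
  have hgy : g y = constSep k c * y := by rw [hc]; field_simp
  refine ⟨y, hyx, ?_⟩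
  by_contra hne
  have hc1 : c - 1 ≠ 0 := by
    intro h
    rw [sub_eq_zero.1 h, map_one, one_mul] at hgy
    exact hne hgy
  have h1 : sepNorm k (g y - 1) < 1 := by
    rw [← map_one g, ← map_sub, sepNorm_galois]
    exact hy1
  -- `g y = c y` with `c ≠ 1` would give `‖g y - y‖ = ‖y‖ ≥ 1`, though both are close to `1`
  have h2 := sepNorm_add_le (g y - 1) (1 - y)
  rw [sub_add_sub_cancel, hgy, ← sub_one_mul, ← map_one (constSep k), ← map_sub, map_mul,
    sepNorm_const hc1, one_mul, map_one, ← hgy, map_sub_rev _ 1] at h2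
  exact absurd (hynorm.trans h2) (not_le.2 (max_lt h1 hy1))

lemma exists_fixed_root_of_norm_eq_one {ℓ : ℕ} (hℓ : (ℓ : k) ≠ 0) (g : Inertia k)
    {x : KSep k} (hgx : g x = x) (hx : sepNorm k x = 1) :
    ∃ y, y ^ ℓ = x ∧ g y = y := by
  have hpos : 0 < ℓ := Nat.pos_of_ne_zero fun h => hℓ (by simp [h])
  obtain ⟨c, hc⟩ := exists_norm_sub_const_lt_one hx.le
  have hc0 : c ≠ 0 := by
    rintro rfl
    simp [hx] at hc
  obtain ⟨b, hb⟩ := IsAlgClosed.exists_pow_nat_eq c hpos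
  have hcc : constSep k c ≠ 0 := (_root_.map_ne_zero _).2 hc0
  obtain ⟨y, hy, hgy⟩ := exists_fixed_root_of_norm_sub_one_lt (x := x / constSep k c) hℓ g
    (by rw [map_div₀, hgx, galois_const]) (by
      have : x - constSep k c = constSep k c * (x / constSep k c - 1) := by field_simp
      rwa [this, map_mul, sepNorm_const hc0, one_mul] at hc)
  refine ⟨constSep k b * y, ?_, by rw [map_mul, galois_const, hgy]⟩
  rw [mul_pow, ← map_pow, hb, hy]
  field_simp

namespace IsRootTower

variable {ℓ : ℕ} {τ : ℕ → KSep k} (hτ : IsRootTower ℓ τ)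
include hτ

/-- In the fixed field of an element `g` fixing all `τ n`, every element is an `ℓ`-th power. -/
lemma exists_fixed_root [Fact ℓ.Prime] (hℓ : (ℓ : k) ≠ 0) {g : Inertia k}
    (hg : ∀ n, g (τ n) = τ n) {x : KSep k} (hgx : g x = x) :
    ∃ y, y ^ ℓ = x ∧ g y = y := by
  have hpr : ℓ.Prime := Fact.out
  rcases eq_or_ne x 0 with rfl | hx
  · exact ⟨0, by simp [hpr.ne_zero], by simp⟩
  obtain ⟨m, hm, a, hma⟩ := sepNorm_pow_eq hx
  -- write `‖x‖ ^ m = ‖t‖ ^ a` with `m = ℓ ^ j * b` and `ℓ ∤ b`; then `x ^ b` is a unit times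
  -- `τ j ^ a`
  obtain ⟨j, b, hb, rfl⟩ := Nat.exists_eq_pow_mul_and_not_dvd hm.ne' ℓ hpr.ne_one
  have hτ0 := hτ.ne_zero j
  have hnorm : sepNorm k (x ^ b) = sepNorm k (τ j ^ a) := by
    refine (pow_left_inj₀ (apply_nonneg _ _) (apply_nonneg _ _)
      (pow_ne_zero j hpr.ne_zero)).1 ?_
    rw [← map_pow, ← map_pow, ← pow_mul, mul_comm, map_pow, hma, ← hτ.pow_eq j,
      ← zpow_natCast, ← zpow_natCast, ← zpow_mul, mul_comm, zpow_mul, map_zpow₀,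
      map_zpow₀, zpow_natCast, zpow_natCast, map_pow]
  obtain ⟨y, hy, hgy⟩ := exists_fixed_root_of_norm_eq_one (x := x ^ b / τ j ^ a) hℓ g
    (by rw [map_div₀, map_pow, map_zpow₀, hgx, hg]) (by
      rw [map_div₀, hnorm, div_self]
      exact (_root_.map_ne_zero _).2 (zpow_ne_zero _ hτ0))
  set w := τ (j + 1) ^ a * y with hw
  have hwx : w ^ ℓ = x ^ b := by
    have h1 : (τ (j + 1) ^ a) ^ ℓ = τ j ^ a := by
      rw [← hτ.succ_pow j, ← zpow_natCast, ← zpow_natCast, ← zpow_mul, ← zpow_mul, mul_comm]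
    rw [hw, mul_pow, hy, h1]
    field_simp
  have hgw : g w = w := by rw [hw, map_mul, map_zpow₀, hg, hgy]
  -- `x ^ b` is an `ℓ`-th power and `b` is prime to `ℓ`, so `x` is an `ℓ`-th power by Bézout
  have hbez : (1 : ℤ) = b * b.gcdA ℓ + ℓ * b.gcdB ℓ := by
    rw [← Nat.gcd_eq_gcd_ab, ((Nat.Prime.coprime_iff_not_dvd hpr).2 hb).symm]
    rfl
  refine ⟨w ^ b.gcdA ℓ * x ^ b.gcdB ℓ, ?_, by rw [map_mul, map_zpow₀, map_zpow₀, hgw, hgx]⟩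
  have h1 : (w ^ b.gcdA ℓ) ^ ℓ = x ^ (b * b.gcdA ℓ) := by
    rw [zpow_mul, zpow_natCast x b, ← hwx, ← zpow_natCast, ← zpow_natCast, ← zpow_mul, ← zpow_mul,
      mul_comm]
  have h2 : (x ^ b.gcdB ℓ) ^ ℓ = x ^ (ℓ * b.gcdB ℓ) := by
    rw [← zpow_natCast, ← zpow_mul, mul_comm]
  rw [mul_pow, h1, h2, ← zpow_add₀ hx, ← hbez, zpow_one]

/-- A nontrivial `ℓ`-th root of unity is not an eigenvalue of `g`: an eigenvector `v` has `v ^ ℓ`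
fixed by `g`, so by `exists_fixed_root` it is a fixed vector up to a constant. -/
lemma eq_zero_of_eigenvalue [Fact ℓ.Prime] (hℓ : (ℓ : k) ≠ 0) {g : Inertia k}
    (hg : ∀ n, g (τ n) = τ n) {c : k} (hc : c ^ ℓ = 1) (hc1 : c ≠ 1) {v : KSep k}
    (hv : g v = constSep k c * v) : v = 0 := by
  by_contra hv0
  have hpr : ℓ.Prime := Fact.out
  obtain ⟨y, hy, hgy⟩ := hτ.exists_fixed_root hℓ hg (x := v ^ ℓ)
    (by rw [map_pow, hv, mul_pow, ← map_pow, hc, map_one, one_mul])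
  have hy0 : y ≠ 0 := by
    rintro rfl
    rw [zero_pow hpr.ne_zero] at hy
    exact pow_ne_zero _ hv0 hy.symm
  obtain ⟨d, -, hd⟩ := exists_const_eq_of_pow_eq_one (x := v / y) hpr.pos
    (by rw [div_pow, hy, div_self (pow_ne_zero _ hv0)])
  have hvd : v = constSep k d * y := by rw [hd]; field_simp
  have hgv : g v = v := by rw [hvd, map_mul, galois_const, hgy]
  rw [hgv] at hv
  have := mul_right_cancel₀ hv0 ((one_mul v).trans hv)
  exact hc1 ((constSep k).injective (this.symm.trans (map_one _).symm))

/-- The fixed fields of `g` and of `g ^ ℓ` coincide. On the latter `g` is annihilated by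
`X ^ ℓ - 1 = (X - 1) * f`, where `f` splits over `k` and `f (g)` is injective by
`eq_zero_of_eigenvalue`. -/
lemma fixed_of_pow_fixed [Fact ℓ.Prime] (hℓ : (ℓ : k) ≠ 0) {g : Inertia k}
    (hg : ∀ n, g (τ n) = τ n) {x : KSep k} (hx : (g ^ ℓ) x = x) : g x = x := by
  have hpr : ℓ.Prime := Fact.out
  let T : Module.End k⸨X⸩ (KSep k) := g.toLinearMap
  have hT : ∀ (n : ℕ) y, (T ^ n) y = (g ^ n) y := by
    intro n
    induction n with
    | zero => intro y; rfl
    | succ n ih => intro y; rw [pow_succ, pow_succ]; exact ih _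
  let f : k[X] := ∑ i ∈ Finset.range ℓ, X ^ i
  have hf : f * (X - 1) = X ^ ℓ - 1 := geom_sum_mul X ℓ
  have hf1 : f.eval 1 ≠ 0 := by simpa [f, eval_finsetSum] using hℓ
  have hmonic : f.Monic := monic_geom_sum_X hpr.ne_zero
  have hroot : ∀ r ∈ f.roots, r ^ ℓ = 1 ∧ r ≠ 1 := by
    intro r hr
    have hr0 : f.eval r = 0 := (mem_roots'.1 hr).2
    refine ⟨?_, ?_⟩
    · have := congrArg (eval r) hf
      rw [eval_mul, hr0, zero_mul] at this
      simpa [sub_eq_zero] using this.symm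
    · rintro rfl
      exact hf1 hr0
  have hprod : ∀ s : Multiset k, (∀ r ∈ s, r ^ ℓ = 1 ∧ r ≠ 1) → ∀ y,
      aeval T ((s.map fun r => X - C r).prod.map (HahnSeries.C : k →+* k⸨X⸩)) y = 0 → y = 0 := by
    intro s
    induction s using Multiset.induction with
    | empty => intro _ y hy; simpa using hy
    | cons r s ih =>
      intro hs y hy
      refine ih (fun q hq => hs q (Multiset.mem_cons_of_mem hq)) y ?_
      have hr := hs r (Multiset.mem_cons_self r s)
      refine hτ.eq_zero_of_eigenvalue hℓ hg hr.1 hr.2 ?_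
      rw [Multiset.map_cons, Multiset.prod_cons, Polynomial.map_mul, map_mul,
        Module.End.mul_apply] at hy
      simpa [sub_eq_zero, Algebra.smul_def, T, constSep] using hy
  have hy : T x - x = 0 := by
    refine hprod f.roots hroot _ ?_
    rw [← (IsAlgClosed.splits f).eq_prod_roots_of_monic hmonic]
    have h1 : aeval T ((f * (X - 1)).map (HahnSeries.C : k →+* k⸨X⸩)) x = 0 := by
      rw [hf]
      simp [hT, hx]
    rw [Polynomial.map_mul, map_mul, Module.End.mul_apply] at h1
    simpa using h1
  exact sub_eq_zero.1 hy

/-- The group of automorphisms fixing all `τ n` is prime to `ℓ`: some power of `g` lies in a given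
open subgroup, and `fixed_of_pow_fixed` removes the powers of `ℓ` from its exponent. -/
lemma exists_coprime_pow_mem [Fact ℓ.Prime] (hℓ : (ℓ : k) ≠ 0) {g : Inertia k}
    (hg : ∀ n, g (τ n) = τ n) {U : Set (Inertia k)} (hU : U ∈ nhds 1) :
    ∃ n : ℕ, n.Coprime ℓ ∧ g ^ n ∈ U := by
  have hpr : ℓ.Prime := Fact.out
  obtain ⟨E, hE, hEU⟩ := (krullTopology_mem_nhds_one_iff _ _ U).1 hU
  have := Subgroup.quotient_finite_of_isOpen E.fixingSubgroup E.fixingSubgroup_isOpen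
  have := Subgroup.finiteIndex_of_finite_quotient (H := E.fixingSubgroup)
  obtain ⟨n, hn, -, hgn⟩ := Subgroup.exists_pow_mem_of_index_ne_zero
    (H := E.fixingSubgroup) Subgroup.FiniteIndex.index_ne_zero g
  obtain ⟨j, m, hm, rfl⟩ := Nat.exists_eq_pow_mul_and_not_dvd hn.ne' ℓ hpr.ne_one
  refine ⟨m, ((Nat.Prime.coprime_iff_not_dvd hpr).2 hm).symm, hEU ?_⟩
  have hpow : ∀ i n, (g ^ i) (τ n) = τ n := fun i n =>
    (MulAction.stabilizer (Inertia k) (τ n)).pow_mem (hg n) i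
  have key : ∀ (j : ℕ) x, (g ^ (ℓ ^ j * m)) x = x → (g ^ m) x = x := by
    intro j
    induction j with
    | zero => intro x hx; simpa using hx
    | succ j ih =>
      intro x hx
      refine ih x (hτ.fixed_of_pow_fixed hℓ (hpow _) ?_)
      rwa [← pow_mul, mul_right_comm, ← pow_succ]
  exact (IntermediateField.mem_fixingSubgroup_iff E _).2 fun x hx =>
    key j x ((IntermediateField.mem_fixingSubgroup_iff E _).1 hgn x hx)

lemma exists_map_eq_const_mul [Fact ℓ.Prime] (g : Inertia k) (n : ℕ) :
    ∃ c : k, c ^ ℓ ^ n = 1 ∧ g (τ n) = constSep k c * τ n := by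
  have hpr : ℓ.Prime := Fact.out
  have h0 := hτ.ne_zero n
  obtain ⟨c, hc, hcx⟩ := exists_const_eq_of_pow_eq_one (x := g (τ n) / τ n)
    (pow_pos hpr.pos n) (by
      rw [div_pow, ← map_pow, hτ.pow_eq, uniformizerSep, AlgEquiv.commutes, div_self]
      rw [← uniformizerSep, ← hτ.pow_eq n]
      exact pow_ne_zero _ h0)
  exact ⟨c, hc, by rw [hcx]; field_simp⟩

lemma stabilizer_normal [Fact ℓ.Prime] (n : ℕ) :
    (MulAction.stabilizer (Inertia k) (τ n)).Normal := by
  refine ⟨fun σ hσ g => ?_⟩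
  obtain ⟨c, -, hc⟩ := hτ.exists_map_eq_const_mul g⁻¹ n
  change σ (τ n) = τ n at hσ
  change g (σ (g⁻¹ (τ n))) = τ n
  rw [hc, map_mul, galois_const, hσ, ← hc]
  exact g.apply_symm_apply _

lemma exists_isPrimitiveRoot [Fact ℓ.Prime] {g : Inertia k} (hg : g (τ 1) ≠ τ 1) (n : ℕ) :
    ∃ c : k, IsPrimitiveRoot c (ℓ ^ n) ∧ g (τ n) = constSep k c * τ n := by
  obtain ⟨c, hc, hgc⟩ := hτ.exists_map_eq_const_mul g n
  refine ⟨c, ?_, hgc⟩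
  cases n with
  | zero => simpa using hc
  | succ n =>
    rw [IsPrimitiveRoot.iff_orderOf]
    refine orderOf_eq_prime_pow (fun h => hg ?_) hc
    have h1 := hτ.add_pow 1 n
    rw [add_comm] at h1
    rw [← h1, map_pow, hgc, mul_pow, ← map_pow, h, map_one, one_mul]

/-- `g` generates the quotient of `I` by the stabilizer of `τ n`, since `g (τ n) / τ n` is a
primitive `ℓ ^ n`-th root of unity. -/
lemma exists_pow_inv_mul_mem [Fact ℓ.Prime] {g : Inertia k} (hg : g (τ 1) ≠ τ 1)
    (h : Inertia k) (n : ℕ) :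
    ∃ i : ℕ, (g ^ i)⁻¹ * h ∈ MulAction.stabilizer (Inertia k) (τ n) := by
  have : NeZero ℓ := ⟨(Fact.out : ℓ.Prime).ne_zero⟩
  obtain ⟨c, hc, hgc⟩ := hτ.exists_isPrimitiveRoot hg n
  obtain ⟨d, hd, hhd⟩ := hτ.exists_map_eq_const_mul h n
  obtain ⟨i, -, hi⟩ := hc.eq_pow_of_pow_eq_one hd
  refine ⟨i, ?_⟩
  rw [MulAction.mem_stabilizer_iff, mul_smul, inv_smul_eq_iff]
  change h (τ n) = (g ^ i) (τ n)
  rw [hhd, galois_pow_apply hgc, hi]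

lemma dvd_of_pow_mem [Fact ℓ.Prime] {g : Inertia k} (hg : g (τ 1) ≠ τ 1) {n i : ℕ}
    (h : g ^ i ∈ MulAction.stabilizer (Inertia k) (τ n)) : ℓ ^ n ∣ i := by
  obtain ⟨c, hc, hgc⟩ := hτ.exists_isPrimitiveRoot hg n
  change (g ^ i) (τ n) = τ n at h
  rw [galois_pow_apply hgc] at h
  refine hc.dvd_of_pow_eq_one i ((constSep k).injective ?_)
  rw [map_one]
  exact mul_right_cancel₀ (hτ.ne_zero n) (h.trans (one_mul _).symm)

end IsRootTower

end Roots

/-! ### Tameness of the tower -/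

/-- The residue field of `k⟦X⟧` is `k`, hence perfect. -/
lemma isSeparable_residue [PerfectField k] {B : Type*} [CommRing B] [Algebra k⟦X⟧ B]
    [Algebra.IsIntegral k⟦X⟧ B] (𝔓 : Ideal B) [𝔓.IsMaximal]
    [𝔓.LiesOver (IsLocalRing.maximalIdeal k⟦X⟧)] :
    Algebra.IsSeparable (k⟦X⟧ ⧸ IsLocalRing.maximalIdeal k⟦X⟧) (B ⧸ 𝔓) := by
  let : Field (B ⧸ 𝔓) := Ideal.Quotient.field 𝔓
  let : Field (k⟦X⟧ ⧸ IsLocalRing.maximalIdeal k⟦X⟧) := Ideal.Quotient.field _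
  have : PerfectField (k⟦X⟧ ⧸ IsLocalRing.maximalIdeal k⟦X⟧) :=
    PerfectField.of_ringEquiv (PowerSeries.residueFieldOfPowerSeries (k := k)).symm
  have : Algebra.IsIntegral (k⟦X⟧ ⧸ IsLocalRing.maximalIdeal k⟦X⟧) (B ⧸ 𝔓) := inferInstance
  have : Algebra.IsAlgebraic (k⟦X⟧ ⧸ IsLocalRing.maximalIdeal k⟦X⟧) (B ⧸ 𝔓) := inferInstance
  infer_instance

/-- In a Galois extension the ramification index divides the degree. -/
lemma isFiniteTame_of_isGalois [PerfectField k] {p : ℕ} (E : IntermediateField k⸨X⸩ (KSep k))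
    [FiniteDimensional k⸨X⸩ E] [IsGalois k⸨X⸩ E] (hp : p.Coprime (Nat.card Gal(E/k⸨X⸩))) :
    IsFiniteTame p E := by
  refine ⟨inferInstance, fun 𝔓 _ _ => ⟨hp.coprime_dvd_right ?_, isSeparable_residue 𝔓⟩⟩
  have : IsDedekindDomain (integralClosure k⟦X⟧ E) :=
    IsIntegralClosure.isDedekindDomain k⟦X⟧ k⸨X⸩ E _
  have : Module.Finite k⟦X⟧ (integralClosure k⟦X⟧ E) :=
    IsIntegralClosure.finite k⟦X⟧ k⸨X⸩ E _
  have : IsFractionRing (integralClosure k⟦X⟧ E) E :=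
    IsIntegralClosure.isFractionRing_of_finite_extension k⟦X⟧ k⸨X⸩ E _
  have : Module.IsTorsionFree k⟦X⟧ (integralClosure k⟦X⟧ E) := by
    have hinj : Function.Injective (algebraMap k⟦X⟧ E) := by
      rw [IsScalarTower.algebraMap_eq k⟦X⟧ k⸨X⸩ E]
      exact (algebraMap k⸨X⸩ E).injective.comp (IsFractionRing.injective k⟦X⟧ k⸨X⸩)
    refine Module.isTorsionFree_iff_algebraMap_injective.2
      (Function.Injective.of_comp (f := algebraMap (integralClosure k⟦X⟧ E) E) ?_)
    rwa [← RingHom.coe_comp, ← IsScalarTower.algebraMap_eq]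
  have : Module.Flat k⟦X⟧ (integralClosure k⟦X⟧ E) := inferInstance
  let : MulSemiringAction Gal(E/k⸨X⸩) (integralClosure k⟦X⟧ E) :=
    IsIntegralClosure.MulSemiringAction k⟦X⟧ k⸨X⸩ E _
  have : IsGaloisGroup Gal(E/k⸨X⸩) k⟦X⟧ (integralClosure k⟦X⟧ E) :=
    IsGaloisGroup.of_isFractionRing _ _ _ k⸨X⸩ E
  have hprime : 𝔓.IsPrime := Ideal.IsMaximal.isPrime inferInstance
  rw [← Ideal.ncard_primesOver_mul_ramificationIdxIn_mul_inertiaDegIn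
    (IsLocalRing.maximalIdeal k⟦X⟧) (integralClosure k⟦X⟧ E) Gal(E/k⸨X⸩),
    Ideal.ramificationIdxIn_eq_ramificationIdx _ 𝔓 Gal(E/k⸨X⸩)]
  exact Dvd.dvd.mul_left (Dvd.intro _ rfl) _

open IntermediateField in
/-- `K(τ n)` is a Kummer extension with Galois group embedded in the `ℓ ^ n`-th roots of unity. -/
lemma IsRootTower.isFiniteTame_adjoin [IsAlgClosed k] {ℓ p : ℕ} [Fact ℓ.Prime] (hp : p.Coprime ℓ)
    {τ : ℕ → KSep k} (hτ : IsRootTower ℓ τ) (n : ℕ) : IsFiniteTame p k⸨X⸩⟮τ n⟯ := by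
  have : FiniteDimensional k⸨X⸩ k⸨X⸩⟮τ n⟯ :=
    adjoin.finiteDimensional (Algebra.IsIntegral.isIntegral _)
  have : Normal k⸨X⸩ k⸨X⸩⟮τ n⟯ := by
    refine normal_iff_forall_map_le'.2 fun σ => ?_
    obtain ⟨c, -, hc⟩ := hτ.exists_map_eq_const_mul σ n
    rw [adjoin_map, adjoin_le_iff, Set.image_singleton, Set.singleton_subset_iff]
    change σ (τ n) ∈ _
    rw [hc]
    exact mul_mem (IntermediateField.algebraMap_mem _ _) (mem_adjoin_simple_self _ _)
  have : IsGalois k⸨X⸩ k⸨X⸩⟮τ n⟯ := ⟨⟩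
  have hpg : IsPGroup ℓ Gal(k⸨X⸩⟮τ n⟯/k⸨X⸩) := by
    intro σ
    refine ⟨n, ?_⟩
    obtain ⟨σ', rfl⟩ := AlgEquiv.restrictNormalHom_surjective (KSep k) σ
    obtain ⟨c, hc1, hc⟩ := hτ.exists_map_eq_const_mul σ' n
    rw [← map_pow]
    refine AlgEquiv.coe_toAlgHom_injective (algHom_ext_of_eq_adjoin _ rfl ?_)
    rintro x rfl
    refine Subtype.ext ?_
    refine (AlgEquiv.restrictNormal_commutes (σ' ^ ℓ ^ n) k⸨X⸩⟮τ n⟯ _).trans ?_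
    change (σ' ^ ℓ ^ n) (τ n) = τ n
    rw [galois_pow_apply hc, hc1, map_one, one_mul]
  obtain ⟨m, hm⟩ := IsPGroup.iff_card.1 hpg
  refine isFiniteTame_of_isGalois _ ?_
  rw [hm]
  exact hp.pow_right m

lemma IsRootTower.wildInertia_le [IsAlgClosed k] {ℓ p : ℕ} [Fact ℓ.Prime] (hp : p.Coprime ℓ)
    {τ : ℕ → KSep k} (hτ : IsRootTower ℓ τ) (n : ℕ) :
    wildInertia p k ≤ MulAction.stabilizer (Inertia k) (τ n) := by
  intro σ hσ
  refine (IntermediateField.mem_fixingSubgroup_iff _ _).1 hσ (τ n) ?_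
  exact le_iSup₂_of_le (f := fun E (_ : IsFiniteTame p E) => E) _
    (hτ.isFiniteTame_adjoin hp n) le_rfl
    (IntermediateField.mem_adjoin_simple_self _ _)


/-! ### Powers of matrices close to the identity -/

section Matrix

-- the norm of a matrix is the maximum of the norms of its entries
attribute [local instance] Matrix.normedAddCommGroup Matrix.normedSpace

variable {ι 𝕜 : Type*} [Fintype ι] [NormedField 𝕜]

lemma matrix_norm_natCast_mul [DecidableEq ι] (n : ℕ) (A : Matrix ι ι 𝕜) :
    ‖(n : Matrix ι ι 𝕜) * A‖ = ‖(n : 𝕜)‖ * ‖A‖ := by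
  have : (n : Matrix ι ι 𝕜) * A = (n : 𝕜) • A := by
    rw [← nsmul_eq_mul, Nat.cast_smul_eq_nsmul]
  rw [this, norm_smul]

variable [IsUltrametricDist 𝕜]

lemma matrix_norm_add_le (A B : Matrix ι ι 𝕜) : ‖A + B‖ ≤ max ‖A‖ ‖B‖ := by
  refine (Matrix.norm_le_iff (le_max_of_le_left (norm_nonneg A))).2 fun i j => ?_
  exact (IsUltrametricDist.norm_add_le_max _ _).trans
    (max_le_max (A.norm_entry_le_entrywise_sup_norm) (B.norm_entry_le_entrywise_sup_norm))

lemma matrix_norm_mul_le (A B : Matrix ι ι 𝕜) : ‖A * B‖ ≤ ‖A‖ * ‖B‖ := by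
  have h0 : 0 ≤ ‖A‖ * ‖B‖ := mul_nonneg (norm_nonneg A) (norm_nonneg B)
  refine (Matrix.norm_le_iff h0).2 fun i j => ?_
  rw [Matrix.mul_apply]
  refine IsUltrametricDist.norm_sum_le_of_forall_le_of_nonneg h0 fun l _ => ?_
  rw [norm_mul]
  exact mul_le_mul A.norm_entry_le_entrywise_sup_norm B.norm_entry_le_entrywise_sup_norm
    (norm_nonneg _) (norm_nonneg A)

variable [DecidableEq ι]

/-- The binomial expansion of `(1 + (A - 1)) ^ n` up to first order. -/
lemma matrix_norm_pow_sub_le {A : Matrix ι ι 𝕜} (hA : ‖A - 1‖ ≤ 1) (n : ℕ) :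
    ‖A ^ n - 1 - n * (A - 1)‖ ≤ ‖A - 1‖ ^ 2 := by
  induction n with
  | zero => simp
  | succ n ih =>
    have h : A ^ (n + 1) - 1 - ((n + 1 : ℕ) : Matrix ι ι 𝕜) * (A - 1)
        = (A ^ n - 1 - n * (A - 1)) + ((A ^ n - 1 - n * (A - 1)) * (A - 1)
          + n * ((A - 1) * (A - 1))) := by
      push_cast
      noncomm_ring
    rw [h]
    refine (matrix_norm_add_le _ _).trans (max_le ih ((matrix_norm_add_le _ _).trans
      (max_le ?_ ?_)))
    · exact (matrix_norm_mul_le _ _).trans ((mul_le_of_le_one_right (norm_nonneg _) hA).trans ih)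
    · rw [matrix_norm_natCast_mul]
      refine (mul_le_of_le_one_left (norm_nonneg _)
        (IsUltrametricDist.norm_natCast_le_one 𝕜 n)).trans ?_
      rw [sq]
      exact matrix_norm_mul_le _ _

/-- If `‖A - 1‖ < 1` and `n` has norm `1` in `𝕜` then `‖A ^ n - 1‖ = ‖A - 1‖`, so `A ^ n` comes
close to `1` for such `n` only if `A = 1`. -/
lemma matrix_eq_one_of_norm_pow_sub_lt {A : Matrix ι ι 𝕜} (hA : ‖A - 1‖ < 1)
    (h : ∀ ε > 0, ∃ n : ℕ, ‖(n : 𝕜)‖ = 1 ∧ ‖A ^ n - 1‖ < ε) : A = 1 := by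
  by_contra hne
  have hpos : 0 < ‖A - 1‖ := norm_pos_iff.2 (sub_ne_zero.2 hne)
  obtain ⟨n, hn, hlt⟩ := h _ hpos
  have h1 := matrix_norm_natCast_mul n (A - 1)
  rw [hn, one_mul] at h1
  have h2 := matrix_norm_add_le (A ^ n - 1) (-(A ^ n - 1 - (n : Matrix ι ι 𝕜) * (A - 1)))
  rw [norm_neg, ← sub_eq_add_neg, sub_sub_cancel, h1] at h2
  refine absurd h2 (not_le.2 (max_lt hlt ((matrix_norm_pow_sub_le hA.le n).trans_lt ?_)))
  rw [sq]
  exact mul_lt_of_lt_one_left hpos hA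

end Matrix

/-! ### Closed conditions on continuous representations -/

section Continuous

variable {𝕜 G V : Type*} [Field 𝕜] [TopologicalSpace 𝕜] [T2Space 𝕜] [Group G] [TopologicalSpace G]
  [AddCommGroup V] [Module 𝕜 V] {ρ : Representation 𝕜 G V}

lemma IsContinuousRep.isClosed_setOf_eq (hρ : IsContinuousRep ρ) (T : Module.End 𝕜 V) :
    IsClosed {g : G | ρ g = T} := by
  have : {g : G | ρ g = T} = ⋂ (v : V) (f : Module.Dual 𝕜 V), {g | f (ρ g v) = f (T v)} := by
    ext g
    simp only [Set.mem_ofPred_eq, Set.mem_iInter]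
    refine ⟨fun h v f => by rw [h], fun h => LinearMap.ext fun v => ?_⟩
    exact (Module.forall_dual_apply_eq_zero_iff 𝕜 _).1 (fun f => by
      rw [map_sub, h v f, sub_self]) |> sub_eq_zero.1
  rw [this]
  exact isClosed_iInter fun v => isClosed_iInter fun f => isClosed_eq (hρ v f) continuous_const

lemma IsContinuousRep.isClosed_setOf_mem (hρ : IsContinuousRep ρ) {F : Set (Module.End 𝕜 V)}
    (hF : F.Finite) : IsClosed {g : G | ρ g ∈ F} := by
  have : {g : G | ρ g ∈ F} = ⋃ T ∈ F, {g | ρ g = T} := by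
    ext g
    simp
  rw [this]
  exact hF.isClosed_biUnion fun T _ => hρ.isClosed_setOf_eq T

lemma IsContinuousRep.isClosed_setOf_commute (hρ : IsContinuousRep ρ) (T : Module.End 𝕜 V) :
    IsClosed {g : G | Commute T (ρ g)} := by
  have : {g : G | Commute T (ρ g)}
      = ⋂ (v : V) (f : Module.Dual 𝕜 V), {g | (f ∘ₗ T) (ρ g v) = f (ρ g (T v))} := by
    ext g
    simp only [Set.mem_ofPred_eq, Set.mem_iInter]
    refine ⟨fun h v f => congrArg f (LinearMap.congr_fun h v), fun h => LinearMap.ext fun v => ?_⟩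
    exact (Module.forall_dual_apply_eq_zero_iff 𝕜 _).1 (fun f => by
      rw [map_sub]; exact sub_eq_zero.2 (h v f)) |> sub_eq_zero.1
  rw [this]
  exact isClosed_iInter fun v => isClosed_iInter fun f => isClosed_eq (hρ v _) (hρ _ f)

end Continuous

/-! ### Procyclic quotients -/

/-- `S` is a decreasing sequence of open normal subgroups such that `g` generates every `G / S n`,
and the order of `g` in `G / S n` is divisible by `ℓ ^ n`. In the application `G / ⋂ n, S n` is
`ℤ_ℓ`. -/
structure IsProcyclicTower {G : Type*} [Group G] [TopologicalSpace G] (ℓ : ℕ)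
    (S : ℕ → Subgroup G) (g : G) : Prop where
  isOpen (n : ℕ) : IsOpen (S n : Set G)
  normal (n : ℕ) : (S n).Normal
  antitone : Antitone S
  exists_pow (h : G) (n : ℕ) : ∃ i : ℕ, (g ^ i)⁻¹ * h ∈ S n
  dvd_of_pow_mem {n i : ℕ} : g ^ i ∈ S n → ℓ ^ n ∣ i

namespace IsProcyclicTower

variable {G : Type*} [Group G] [TopologicalSpace G] {ℓ : ℕ}
  {S : ℕ → Subgroup G} {g : G} (hS : IsProcyclicTower ℓ S g)
include hS

/-- By compactness `G` is the product of the closure of the powers of `g` and of `⋂ n, S n`. -/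
lemma exists_mem_closure [IsTopologicalGroup G] [CompactSpace G] (h : G) :
    ∃ z ∈ closure (Set.range fun i : ℕ => g ^ i), z⁻¹ * h ∈ ⨅ n, S n := by
  let A : ℕ → Set G := fun n => closure (Set.range fun i : ℕ => g ^ i) ∩ {z | z⁻¹ * h ∈ S n}
  have hclosed : ∀ n, IsClosed (A n) := fun n =>
    isClosed_closure.inter ((Subgroup.isClosed_of_isOpen _ (hS.isOpen n)).preimage
      (continuous_inv.mul continuous_const))
  obtain ⟨z, hz⟩ := IsCompact.nonempty_iInter_of_sequence_nonempty_isCompact_isClosed A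
    (fun n z hz => ⟨hz.1, hS.antitone n.le_succ hz.2⟩)
    (fun n => by
      obtain ⟨i, hi⟩ := hS.exists_pow h n
      exact ⟨g ^ i, subset_closure ⟨i, rfl⟩, hi⟩) (hclosed 0).isCompact hclosed
  rw [Set.mem_iInter] at hz
  exact ⟨z, (hz 0).1, Subgroup.mem_iInf.2 fun n => (hz n).2⟩

lemma dvd_sub {n i j : ℕ} (hij : i ≤ j) {h : G} (hi : (g ^ i)⁻¹ * h ∈ S n)
    (hj : (g ^ j)⁻¹ * h ∈ S n) : ℓ ^ n ∣ j - i := by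
  refine hS.dvd_of_pow_mem ?_
  have := (S n).mul_mem hi ((S n).inv_mem hj)
  rwa [mul_inv_rev, inv_inv, mul_assoc, mul_inv_cancel_left, ← Nat.add_sub_cancel' hij, pow_add,
    inv_mul_cancel_left] at this

end IsProcyclicTower

/-! ### One-units of `ℚ̄_ℓ` -/

section OneUnits

variable {ℓ : ℕ} [Fact ℓ.Prime]

lemma norm_eq_one_of_norm_sub_lt_one {x y : PadicAlgCl ℓ} (hy : ‖y‖ = 1) (h : ‖x - y‖ < 1) :
    ‖x‖ = 1 := by
  rw [← hy, ← norm_neg y]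
  refine IsUltrametricDist.norm_eq_of_add_norm_lt_max ?_
  rw [← sub_eq_add_neg, norm_neg, hy]
  exact lt_max_of_lt_right h

lemma norm_pow_sub_one_le {x : PadicAlgCl ℓ} (hx : ‖x - 1‖ ≤ 1) (n : ℕ) :
    ‖x ^ n - 1‖ ≤ ‖x - 1‖ := by
  have hx1 : ‖x‖ ≤ 1 := by
    have := IsUltrametricDist.norm_add_le_max (x - 1) 1
    rw [sub_add_cancel, norm_one] at this
    exact this.trans (max_le hx le_rfl)
  rw [← geom_sum_mul, norm_mul]
  refine mul_le_of_le_one_left (norm_nonneg _)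
    (IsUltrametricDist.norm_sum_le_of_forall_le_of_nonneg zero_le_one fun i _ => ?_)
  rw [norm_pow]
  exact pow_le_one₀ (norm_nonneg _) hx1

/-- With `y = x - 1`, the quotient of `x ^ ℓ - 1` by `y` is congruent to `ℓ` modulo `y`, so raising
to the power `ℓ` contracts one-units towards `1`. -/
lemma norm_pow_prime_sub_one_le {x : PadicAlgCl ℓ} {r : ℝ} (hr : r ≤ 1)
    (hℓ : ‖(ℓ : PadicAlgCl ℓ)‖ ≤ r) (hx : ‖x - 1‖ ≤ r) : ‖x ^ ℓ - 1‖ ≤ r * ‖x - 1‖ := by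
  rw [← geom_sum_mul, norm_mul]
  refine mul_le_mul_of_nonneg_right ?_ (norm_nonneg _)
  have h : ∑ i ∈ Finset.range ℓ, x ^ i = ∑ i ∈ Finset.range ℓ, (x ^ i - 1) + ℓ := by simp
  rw [h]
  refine (IsUltrametricDist.norm_add_le_max _ _).trans (max_le ?_ hℓ)
  exact IsUltrametricDist.norm_sum_le_of_forall_le_of_nonneg ((norm_nonneg _).trans hx)
    fun i _ => (norm_pow_sub_one_le (hx.trans hr) i).trans hx

lemma exists_norm_pow_prime_pow_sub_one_le {x : PadicAlgCl ℓ} (hx : ‖x - 1‖ < 1) :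
    ∃ r : ℝ, 0 ≤ r ∧ r < 1 ∧ ∀ n, ‖x ^ ℓ ^ n - 1‖ ≤ r ^ n := by
  have hℓ : ‖(ℓ : PadicAlgCl ℓ)‖ < 1 := by
    rw [← map_natCast (algebraMap ℚ_[ℓ] (PadicAlgCl ℓ)), norm_algebraMap']
    exact Padic.norm_p_lt_one
  set r := max ‖(ℓ : PadicAlgCl ℓ)‖ ‖x - 1‖ with hr
  have hr0 : 0 ≤ r := le_max_of_le_left (norm_nonneg _)
  have hr1 : r < 1 := max_lt hℓ hx
  refine ⟨r, hr0, hr1, fun n => ?_⟩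
  induction n with
  | zero => simpa using hx.le
  | succ n ih =>
    have h1 : ‖x ^ ℓ ^ n - 1‖ ≤ r := (norm_pow_sub_one_le hx.le _).trans (le_max_right _ _)
    rw [pow_succ, pow_mul, pow_succ']
    exact (norm_pow_prime_sub_one_le hr1.le (le_max_left _ _) h1).trans
      (mul_le_mul_of_nonneg_left ih hr0)

lemma norm_natCast_eq_one {n : ℕ} (hn : n.Coprime ℓ) : ‖(n : PadicAlgCl ℓ)‖ = 1 := by
  rw [← map_natCast (algebraMap ℚ_[ℓ] (PadicAlgCl ℓ)), norm_algebraMap']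
  exact Padic.norm_natCast_eq_one_iff.2 hn.symm

/-- A one-unit has roots of every order that are one-units: the product of `1 - a` over all roots
`a` of `X ^ M - c` is `1 - c`. -/
lemma exists_pow_eq_norm_sub_one_lt {c : PadicAlgCl ℓ} (hc : ‖c - 1‖ < 1) {M : ℕ} (hM : 0 < M) :
    ∃ a : PadicAlgCl ℓ, a ^ M = c ∧ ‖a - 1‖ < 1 := by
  have hmonic : (Polynomial.X ^ M - Polynomial.C c).Monic :=
    Polynomial.monic_X_pow_sub_C c hM.ne'
  have hprod := congrArg (Polynomial.eval 1)
    ((IsAlgClosed.splits (Polynomial.X ^ M - Polynomial.C c)).eq_prod_roots_of_monic hmonic)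
  have hlt : ‖Polynomial.eval 1 (Polynomial.X ^ M - Polynomial.C c)‖ < 1 := by
    simpa [norm_sub_rev] using hc
  rw [hprod] at hlt
  by_contra! hcon
  have hroots : ∀ a ∈ (Polynomial.X ^ M - Polynomial.C c).roots, 1 ≤ ‖a - 1‖ := by
    intro a ha
    refine hcon a ?_
    have := (Polynomial.mem_roots'.1 ha).2
    simpa [Polynomial.IsRoot, sub_eq_zero] using this
  refine absurd hlt (not_lt.2 ?_)
  generalize (Polynomial.X ^ M - Polynomial.C c).roots = s at hroots
  induction s using Multiset.induction with
  | empty => simp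
  | cons a s ih =>
    rw [Multiset.map_cons, Multiset.prod_cons, Polynomial.eval_mul, norm_mul]
    refine one_le_mul_of_one_le_of_one_le ?_ (ih fun b hb => hroots b (Multiset.mem_cons_of_mem hb))
    simpa [norm_sub_rev] using hroots a (Multiset.mem_cons_self a s)

end OneUnits

/-! ### Characters of procyclic quotients -/

namespace IsProcyclicTower

variable {G : Type*} [Group G] [TopologicalSpace G] {ℓ : ℕ} [Fact ℓ.Prime]
  {S : ℕ → Subgroup G} {g : G} (hS : IsProcyclicTower ℓ S g)

/-- `x` is the value at `h` of the character sending `g` to `a`: it is the limit of the powers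
`a ^ i` for which `g ^ i` approximates `h`, at the rate `r ^ n` on the cosets of `S n`. -/
def IsCharValue (S : ℕ → Subgroup G) (g : G) (a : PadicAlgCl ℓ) (r : ℝ) (h : G)
    (x : PadicAlgCl ℓ) : Prop :=
  ∀ n i, (g ^ i)⁻¹ * h ∈ S n → ‖x - a ^ i‖ ≤ r ^ n

include hS

section Character

variable {a : PadicAlgCl ℓ} {r : ℝ}

lemma IsCharValue.unique (hr0 : 0 ≤ r) (hr1 : r < 1) {h : G} {x y : PadicAlgCl ℓ}
    (hx : IsCharValue S g a r h x) (hy : IsCharValue S g a r h y) : x = y := by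
  rw [← sub_eq_zero, ← norm_le_zero_iff]
  refine ge_of_tendsto' (tendsto_pow_atTop_nhds_zero_of_lt_one hr0 hr1) fun n => ?_
  obtain ⟨i, hi⟩ := hS.exists_pow h n
  have := IsUltrametricDist.norm_add_le_max (x - a ^ i) (a ^ i - y)
  rw [sub_add_sub_cancel, norm_sub_rev (a ^ i) y] at this
  exact this.trans (max_le (hx n i hi) (hy n i hi))

lemma IsCharValue.norm_eq_one (hr1 : r < 1) (ha1 : ‖a‖ = 1) {h : G} {x : PadicAlgCl ℓ}
    (hx : IsCharValue S g a r h x) : ‖x‖ = 1 := by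
  obtain ⟨i, hi⟩ := hS.exists_pow h 1
  have h1 := (hx 1 i hi).trans_lt (by simpa using hr1)
  exact norm_eq_one_of_norm_sub_lt_one (by rw [norm_pow, ha1, one_pow]) h1

variable (hr0 : 0 ≤ r) (hr1 : r < 1)
  (ha : ∀ n, ‖a ^ ℓ ^ n - 1‖ ≤ r ^ n) (ha1 : ‖a‖ = 1)
include hr0 hr1 ha ha1

lemma norm_pow_sub_pow_le {n i j : ℕ} {h : G} (hi : (g ^ i)⁻¹ * h ∈ S n)
    (hj : (g ^ j)⁻¹ * h ∈ S n) : ‖a ^ i - a ^ j‖ ≤ r ^ n := by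
  wlog hij : j ≤ i generalizing i j
  · rw [norm_sub_rev]
    exact this hj hi (le_of_not_ge hij)
  obtain ⟨q, hq⟩ := hS.dvd_sub hij hj hi
  have : a ^ i - a ^ j = a ^ j * ((a ^ ℓ ^ n) ^ q - 1) := by
    rw [← pow_mul, ← hq, mul_sub, ← pow_add, Nat.add_sub_cancel' hij, mul_one]
  rw [this, norm_mul, norm_pow, ha1, one_pow, one_mul]
  exact (norm_pow_sub_one_le ((ha n).trans (pow_le_one₀ hr0 hr1.le)) q).trans (ha n)

/-- It suffices to test one exponent `i` for every `n`. -/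
lemma isCharValue_of_forall_exists {h : G} {x : PadicAlgCl ℓ}
    (hx : ∀ n, ∃ i, (g ^ i)⁻¹ * h ∈ S n ∧ ‖x - a ^ i‖ ≤ r ^ n) : IsCharValue S g a r h x := by
  intro n j hj
  obtain ⟨i, hi, hxi⟩ := hx n
  have := IsUltrametricDist.norm_add_le_max (x - a ^ i) (a ^ i - a ^ j)
  rw [sub_add_sub_cancel] at this
  exact this.trans (max_le hxi (hS.norm_pow_sub_pow_le hr0 hr1 ha ha1 hi hj))

/-- The limit exists because the powers of `a` lie in `ℚ_ℓ(a)`, which is finite-dimensional over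
`ℚ_ℓ` and therefore complete, unlike `ℚ̄_ℓ`. -/
lemma exists_isCharValue (h : G) : ∃ x, IsCharValue S g a r h x := by
  choose i hi using hS.exists_pow h
  let W : Submodule ℚ_[ℓ] (PadicAlgCl ℓ) :=
    Subalgebra.toSubmodule (Algebra.adjoin ℚ_[ℓ] {a})
  have hfin : FiniteDimensional ℚ_[ℓ] W :=
    Algebra.finite_adjoin_simple_of_isIntegral (Algebra.IsIntegral.isIntegral a)
  have hmem : ∀ n, a ^ i n ∈ W := fun n =>
    (Algebra.adjoin ℚ_[ℓ] {a}).pow_mem (Algebra.self_mem_adjoin_singleton _ a) _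
  have hdist : ∀ n m, n ≤ m → ‖a ^ i m - a ^ i n‖ ≤ r ^ n := fun n m hnm =>
    hS.norm_pow_sub_pow_le hr0 hr1 ha ha1 (hS.antitone hnm (hi m)) (hi n)
  have hcauchy : CauchySeq fun n => a ^ i n := by
    refine cauchySeq_of_le_tendsto_0' (fun n => r ^ n) (fun n m hnm => ?_)
      (tendsto_pow_atTop_nhds_zero_of_lt_one hr0 hr1)
    rw [dist_comm, dist_eq_norm]
    exact hdist n m hnm
  obtain ⟨x, -, hx⟩ := cauchySeq_tendsto_of_isComplete
    (Submodule.complete_of_finiteDimensional W) hmem hcauchy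
  refine ⟨x, hS.isCharValue_of_forall_exists hr0 hr1 ha ha1 fun n => ⟨i n, hi n, ?_⟩⟩
  exact le_of_tendsto (hx.sub_const (a ^ i n)).norm
    (Filter.eventually_atTop.2 ⟨n, fun m hm => hdist n m hm⟩)

lemma isCharValue_one : IsCharValue S g a r 1 1 :=
  hS.isCharValue_of_forall_exists hr0 hr1 ha ha1 fun n =>
    ⟨0, by simp, by simpa using pow_nonneg hr0 n⟩

lemma IsCharValue.mul {h h' : G} {x x' : PadicAlgCl ℓ} (hx : IsCharValue S g a r h x)
    (hx' : IsCharValue S g a r h' x') : IsCharValue S g a r (h * h') (x * x') := by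
  refine hS.isCharValue_of_forall_exists hr0 hr1 ha ha1 fun n => ?_
  obtain ⟨i, hi⟩ := hS.exists_pow h n
  obtain ⟨j, hj⟩ := hS.exists_pow h' n
  refine ⟨i + j, ?_, ?_⟩
  · have h1 := (S n).mul_mem ((hS.normal n).conj_mem _ hi (g ^ j)⁻¹) hj
    convert h1 using 1
    rw [pow_add]
    group
  · have h1 : x * x' - a ^ (i + j) = (x - a ^ i) * x' + a ^ i * (x' - a ^ j) := by ring
    rw [h1]
    refine (IsUltrametricDist.norm_add_le_max _ _).trans (max_le ?_ ?_)
    · rw [norm_mul, IsCharValue.norm_eq_one hS hr1 ha1 hx', mul_one]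
      exact hx n i hi
    · rw [norm_mul, norm_pow, ha1, one_pow, one_mul]
      exact hx' n j hj

end Character

/-- A one-unit `a` is the value at the generator `g` of a continuous character of `G` trivial on
`⋂ n, S n`. -/
theorem exists_character [IsTopologicalGroup G] {a : PadicAlgCl ℓ} (ha : ‖a - 1‖ < 1) :
    ∃ χ : G →ₜ* (PadicAlgCl ℓ)ˣ, (χ g : PadicAlgCl ℓ) = a ∧ ∀ h ∈ ⨅ n, S n, χ h = 1 := by
  obtain ⟨r, hr0, hr1, har⟩ := exists_norm_pow_prime_pow_sub_one_le ha
  have ha1 : ‖a‖ = 1 := norm_eq_one_of_norm_sub_lt_one norm_one ha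
  choose χ hχ using hS.exists_isCharValue hr0 hr1 har ha1
  have huniq : ∀ {h x}, IsCharValue S g a r h x → χ h = x := fun hx =>
    IsCharValue.unique hS hr0 hr1 (hχ _) hx
  let χ₁ : G →* PadicAlgCl ℓ :=
    { toFun := χ
      map_one' := huniq (hS.isCharValue_one hr0 hr1 har ha1)
      map_mul' := fun h h' => huniq (IsCharValue.mul hS hr0 hr1 har ha1 (hχ h) (hχ h')) }
  have hcont : Continuous χ₁.toHomUnits := by
    refine continuous_of_continuousAt_one _ ?_
    refine (Units.isEmbedding_val₀.continuousAt_iff).2 ?_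
    rw [ContinuousAt, Metric.tendsto_nhds]
    intro ε hε
    obtain ⟨n, hn⟩ := exists_pow_lt_of_lt_one hε hr1
    filter_upwards [(hS.isOpen n).mem_nhds (S n).one_mem] with h hh
    have h1 := hχ h n 0 (by simpa using hh)
    rw [pow_zero] at h1
    simp only [Function.comp_apply, map_one, Units.val_one]
    rw [dist_eq_norm]
    exact h1.trans_lt hn
  refine ⟨⟨χ₁.toHomUnits, hcont⟩, ?_, fun h hh => Units.ext ?_⟩
  · exact huniq (hS.isCharValue_of_forall_exists hr0 hr1 har ha1 fun n =>
      ⟨1, by simp, by simpa using pow_nonneg hr0 n⟩)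
  · exact huniq (hS.isCharValue_of_forall_exists hr0 hr1 har ha1 fun n =>
      ⟨0, by simpa using Subgroup.mem_iInf.1 hh n, by simpa using pow_nonneg hr0 n⟩)

end IsProcyclicTower

/-! ### Finiteness of the image after a twist -/

section OpenSubgroup

attribute [local instance] Matrix.normedAddCommGroup Matrix.normedSpace

variable {G : Type*} [Group G] [TopologicalSpace G] {ℓ : ℕ} [Fact ℓ.Prime]
  {V : Type*} [AddCommGroup V] [Module (PadicAlgCl ℓ) V]
  {ρ : Representation (PadicAlgCl ℓ) G V}

lemma IsContinuousRep.continuous_toMatrix {ι : Type*} [Fintype ι] [DecidableEq ι]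
    (hρ : IsContinuousRep ρ) (b : Module.Basis ι (PadicAlgCl ℓ) V) :
    Continuous fun h => LinearMap.toMatrix b b (ρ h) := by
  refine continuous_pi fun i => continuous_pi fun j => ?_
  simp only [LinearMap.toMatrix_apply]
  exact hρ (b j) (b.coord i)

/-- There is an open normal subgroup `U` on which `ρ` is congruent to `1`. Prime-to-`ℓ` elements of
`U` act trivially, and scalars by which elements of `U` act are one-units. -/
lemma IsContinuousRep.exists_openNormalSubgroup [IsTopologicalGroup G] [CompactSpace G]
    [TotallyDisconnectedSpace G] [FiniteDimensional (PadicAlgCl ℓ) V] [Nontrivial V]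
    (hρ : IsContinuousRep ρ) :
    ∃ U : OpenNormalSubgroup G,
      (∀ h ∈ U, (∀ W ∈ nhds (1 : G), ∃ n : ℕ, n.Coprime ℓ ∧ h ^ n ∈ W) → ρ h = 1) ∧
      ∀ h ∈ U, ∀ c : PadicAlgCl ℓ, ρ h = c • 1 → ‖c - 1‖ < 1 := by
  let b := Module.finBasis (PadicAlgCl ℓ) V
  have hcont := (hρ.continuous_toMatrix b).sub (continuous_const (y := 1)) |>.norm
  have hopen : ∀ ε, IsOpen {h : G | ‖LinearMap.toMatrix b b (ρ h) - 1‖ < ε} := fun ε =>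
    isOpen_lt hcont continuous_const
  have hone : ∀ ε > 0, (1 : G) ∈ {h : G | ‖LinearMap.toMatrix b b (ρ h) - 1‖ < ε} := fun ε hε => by
    simpa using hε
  obtain ⟨U, hU⟩ := ProfiniteGrp.exist_openNormalSubgroup_sub_open_nhds_of_one
    (hopen 1) (hone 1 one_pos)
  refine ⟨U, fun h hh hpow => ?_, fun h hh c hc => ?_⟩
  · refine (LinearMap.toMatrix b b).injective ?_
    rw [LinearMap.toMatrix_one]
    refine matrix_eq_one_of_norm_pow_sub_lt (hU hh) fun ε hε => ?_
    obtain ⟨n, hn, hnW⟩ := hpow _ ((hopen ε).mem_nhds (hone ε hε))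
    refine ⟨n, norm_natCast_eq_one hn, ?_⟩
    rw [LinearMap.toMatrix_pow, ← map_pow]
    exact hnW
  · have h1 : ‖LinearMap.toMatrix b b (ρ h) - 1‖ < 1 := hU hh
    have h2 : LinearMap.toMatrix b b (ρ h) - 1 = (c - 1) • (1 : Matrix _ _ (PadicAlgCl ℓ)) := by
      rw [hc, map_smul, LinearMap.toMatrix_one, sub_smul, one_smul]
    rw [h2] at h1
    let i : Fin (Module.finrank (PadicAlgCl ℓ) V) := ⟨0, Module.finrank_pos⟩
    have h3 := Matrix.norm_entry_le_entrywise_sup_norm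
      ((c - 1) • (1 : Matrix (Fin (Module.finrank (PadicAlgCl ℓ) V)) _ (PadicAlgCl ℓ)))
      (i := i) (j := i)
    refine lt_of_le_of_lt ?_ h1
    simpa using h3

end OpenSubgroup

section Twist

variable {G : Type*} [Group G] {𝕜 V : Type*} [Field 𝕜] [AddCommGroup V] [Module 𝕜 V]

/-- The twist `h ↦ χ h • ρ h` on the space of `ρ`, which is identified with the tensor product of
`ρ` with the one-dimensional representation `ofCharacter χ`. -/
def twist (ρ : Representation 𝕜 G V) (χ : G →* 𝕜ˣ) : Representation 𝕜 G V where
  toFun h := (χ h : 𝕜) • ρ h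
  map_one' := by simp
  map_mul' h h' := by
    rw [map_mul, map_mul, Units.val_mul, smul_mul_smul_comm]

lemma finite_range_tprod_ofCharacter {ρ : Representation 𝕜 G V} {χ : G →* 𝕜ˣ}
    (h : (Set.range (twist ρ χ)).Finite) : (Set.range (ρ.tprod (ofCharacter χ))).Finite := by
  refine (h.image fun T => TensorProduct.map T LinearMap.id).subset ?_
  rintro _ ⟨g, rfl⟩
  refine ⟨_, ⟨g, rfl⟩, ?_⟩
  simp [Representation.tprod_apply, twist, ofCharacter, TensorProduct.map_smul_left,
    TensorProduct.map_smul_right]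

lemma IsContinuousRep.twist [TopologicalSpace 𝕜] [IsTopologicalRing 𝕜] [TopologicalSpace G]
    {ρ : Representation 𝕜 G V} (hρ : IsContinuousRep ρ) {χ : G →* 𝕜ˣ} (hχ : Continuous χ) :
    IsContinuousRep (twist ρ χ) := by
  intro v f
  have : (fun g => f (LocalMonodromy.twist ρ χ g v)) = fun g => (χ g : 𝕜) * f (ρ g v) := by
    ext g
    simp [LocalMonodromy.twist]
  rw [this]
  exact (Units.continuous_val.comp hχ).mul (hρ v f)

/-- Schur's lemma. -/
lemma exists_eq_smul_one_of_commute [IsAlgClosed 𝕜] [FiniteDimensional 𝕜 V]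
    {ρ : Representation 𝕜 G V} (hρ : ρ.IsIrreducible) {T : Module.End 𝕜 V}
    (hT : ∀ g, Commute T (ρ g)) : ∃ c : 𝕜, T = c • 1 := by
  let f : Representation.IntertwiningMap ρ ρ :=
    LinearMap.intertwiningMap_of_isIntertwiningMap ρ ρ T fun g v => LinearMap.congr_fun (hT g) v
  obtain ⟨c, hc⟩ :=
    (Representation.IsIrreducible.algebraMap_intertwiningMap_bijective_of_isAlgClosed (ρ := ρ)).2 f
  refine ⟨c, LinearMap.ext fun v => ?_⟩
  have := DFunLike.congr_fun hc v
  exact this.symm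

end Twist

/-- A continuous irreducible representation of a profinite group that is procyclic modulo a
prime-to-`ℓ` subgroup, in the sense of `IsProcyclicTower`, has finite image after a twist by a
character of the procyclic quotient. -/
theorem IsProcyclicTower.exists_twist_finite {G : Type*} [Group G] [TopologicalSpace G]
    [IsTopologicalGroup G] [CompactSpace G] [TotallyDisconnectedSpace G] {ℓ : ℕ} [Fact ℓ.Prime]
    {S : ℕ → Subgroup G} {g : G} (hS : IsProcyclicTower ℓ S g)
    (hpow : ∀ h ∈ ⨅ n, S n, ∀ W ∈ nhds (1 : G), ∃ n : ℕ, n.Coprime ℓ ∧ h ^ n ∈ W)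
    {V : Type*} [AddCommGroup V] [Module (PadicAlgCl ℓ) V] [FiniteDimensional (PadicAlgCl ℓ) V]
    {ρ : Representation (PadicAlgCl ℓ) G V} (hρ : IsContinuousRep ρ) (hirr : ρ.IsIrreducible) :
    ∃ χ : G →ₜ* (PadicAlgCl ℓ)ˣ, (∀ h ∈ ⨅ n, S n, χ h = 1) ∧
      (Set.range (twist ρ (χ : G →* _))).Finite := by
  have hnontriv : Nontrivial V := by
    by_contra hV
    rw [not_nontrivial_iff_subsingleton] at hV
    have := hirr.toNontrivial
    obtain ⟨A, B, hAB⟩ := exists_pair_ne (Subrepresentation ρ)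
    exact hAB (by ext v; simp [Subsingleton.elim v 0])
  obtain ⟨U, hU1, hUc⟩ := hρ.exists_openNormalSubgroup
  have hfinU := Subgroup.quotient_finite_of_isOpen U.toSubgroup U.isOpen
  have hnormal : (⨅ n, S n).Normal := Subgroup.normal_iInf_normal hS.normal
  have hNU : ∀ x ∈ ⨅ n, S n, x ∈ U → ρ x = 1 := fun x hx hxU => hU1 x hxU (hpow x hx)
  -- `ρ` restricted to `⋂ n, S n` factors through the finite quotient by `U`
  have hNfin : (ρ '' (⨅ n, S n : Subgroup G)).Finite := by
    choose! f hf hρf using fun T (hT : T ∈ ρ '' (⨅ n, S n : Subgroup G)) => hT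
    refine Set.Finite.of_injOn (f := fun T => (QuotientGroup.mk (f T) : G ⧸ U.toSubgroup))
      (Set.mapsTo_univ _ _) (fun T hT T' hT' h => ?_) Set.finite_univ
    have h1 : (f T)⁻¹ * f T' ∈ U := QuotientGroup.eq.1 h
    have h2 := hNU _ (mul_mem (inv_mem (hf T hT)) (hf T' hT')) h1
    rw [← hρf T hT, ← hρf T' hT', ← mul_inv_cancel_left (f T) (f T'), map_mul ρ (f T), h2, mul_one]
  obtain ⟨M, hM, -, hgM⟩ := Subgroup.exists_pow_mem_of_index_ne_zero (H := U.toSubgroup)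
    (Subgroup.finiteIndex_of_finite_quotient (H := U.toSubgroup)).index_ne_zero g
  have hcomm : ∀ h, Commute (ρ (g ^ M)) (ρ h) := by
    intro h
    obtain ⟨z, hz, hzh⟩ := hS.exists_mem_closure h
    have hz' : Commute (ρ (g ^ M)) (ρ z) := by
      refine closure_minimal ?_ (hρ.isClosed_setOf_commute (ρ (g ^ M))) hz
      rintro _ ⟨i, rfl⟩
      change Commute _ _
      rw [map_pow, map_pow]
      exact (Commute.refl (ρ g)).pow_pow M i
    -- the commutator of `g ^ M ∈ U` with an element of `⋂ n, S n` lies in both normal subgroups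
    have hx : Commute (ρ (g ^ M)) (ρ (z⁻¹ * h)) := by
      have h1 := hNU (g ^ M * (z⁻¹ * h) * (g ^ M)⁻¹ * (z⁻¹ * h)⁻¹)
        (mul_mem (hnormal.conj_mem _ hzh _) (inv_mem hzh)) (by
          rw [mul_assoc, mul_assoc, ← mul_assoc (z⁻¹ * h)]
          exact mul_mem hgM (U.isNormal'.conj_mem _ (inv_mem hgM) _))
      change _ * _ = _ * _
      rw [← map_mul, ← map_mul]
      have h2 : g ^ M * (z⁻¹ * h) = (g ^ M * (z⁻¹ * h) * (g ^ M)⁻¹ * (z⁻¹ * h)⁻¹)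
        * (z⁻¹ * h * g ^ M) := by group
      rw [h2, map_mul, h1, one_mul]
    have := hz'.mul_right hx
    rwa [← map_mul, mul_inv_cancel_left] at this
  obtain ⟨c, hc⟩ := exists_eq_smul_one_of_commute hirr hcomm
  have hc1 := hUc _ hgM c hc
  have hcnorm : ‖c‖ = 1 := norm_eq_one_of_norm_sub_lt_one norm_one hc1
  have hc0 : c ≠ 0 := by
    rintro rfl
    simp at hcnorm
  have hcinv : ‖c⁻¹ - 1‖ < 1 := by
    have : c⁻¹ - 1 = -(c⁻¹ * (c - 1)) := by field_simp; ring
    rwa [this, norm_neg, norm_mul, norm_inv, hcnorm, inv_one, one_mul]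
  obtain ⟨a, haM, ha⟩ := exists_pow_eq_norm_sub_one_lt hcinv hM
  obtain ⟨χ, hχg, hχN⟩ := hS.exists_character ha
  refine ⟨χ, hχN, ?_⟩
  set σ := twist ρ (χ : G →* (PadicAlgCl ℓ)ˣ) with hσ
  have hσcont : IsContinuousRep σ := hρ.twist χ.continuous_toFun
  have hσg : σ g ^ M = 1 := by
    rw [← map_pow]
    change ((χ (g ^ M) : (PadicAlgCl ℓ)ˣ) : PadicAlgCl ℓ) • ρ (g ^ M) = 1
    rw [map_pow, Units.val_pow_eq_pow_val, hχg, haM, hc, smul_smul, inv_mul_cancel₀ hc0, one_smul]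
  have hpows : (Set.range fun i : ℕ => σ g ^ i).Finite :=
    ((Set.finite_Iio M).image fun i => σ g ^ i).subset (by
      rintro _ ⟨i, rfl⟩
      exact ⟨i % M, Nat.mod_lt i hM, (pow_eq_pow_mod i hσg).symm⟩)
  refine (hpows.mul hNfin).subset ?_
  rintro _ ⟨h, rfl⟩
  obtain ⟨z, hz, hzh⟩ := hS.exists_mem_closure h
  refine ⟨σ z, ?_, ρ (z⁻¹ * h), ⟨_, hzh, rfl⟩, ?_⟩
  · refine closure_minimal ?_ (hσcont.isClosed_setOf_mem hpows) hz
    rintro _ ⟨i, rfl⟩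
    exact ⟨i, (map_pow σ g i).symm⟩
  · have h1 : σ (z⁻¹ * h) = ρ (z⁻¹ * h) := by
      change ((χ (z⁻¹ * h) : (PadicAlgCl ℓ)ˣ) : PadicAlgCl ℓ) • ρ (z⁻¹ * h) = _
      rw [hχN _ hzh, Units.val_one, one_smul]
    change σ z * ρ (z⁻¹ * h) = σ h
    rw [← h1, ← map_mul, mul_inv_cancel_left]

end LocalMonodromy
end

theorem corollary3p3 (p ℓ : ℕ) [Fact p.Prime] [Fact ℓ.Prime] (hℓ : ℓ ≠ p)
    (F k : Type*) [Field F] [Finite F] [CharP F p] [Field k] [Algebra F k] [IsAlgClosure F k]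
    (V : Type*) [AddCommGroup V] [Module (PadicAlgCl ℓ) V] [FiniteDimensional (PadicAlgCl ℓ) V]
    (ρ : Representation (PadicAlgCl ℓ) (LocalMonodromy.Inertia k) V)
    (hcont : LocalMonodromy.IsContinuousRep ρ) (hirr : ρ.IsIrreducible) :
    ∃ χ : LocalMonodromy.Inertia k →ₜ* (PadicAlgCl ℓ)ˣ,
      (∀ g ∈ LocalMonodromy.wildInertia p k, χ g = 1) ∧
        (Set.range (ρ.tprod (LocalMonodromy.ofCharacter (χ : LocalMonodromy.Inertia k →* _)))).Finite := by
  open LocalMonodromy in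
  have : IsAlgClosed k := IsAlgClosure.isAlgClosed F
  have : CharP k p := charP_of_injective_algebraMap (algebraMap F k).injective p
  have hcop : p.Coprime ℓ :=
    (Nat.coprime_primes (Fact.out : p.Prime) (Fact.out : ℓ.Prime)).2 hℓ.symm
  have hℓk : (ℓ : k) ≠ 0 := by
    rw [Ne, CharP.cast_eq_zero_iff k p]
    exact (Nat.Prime.coprime_iff_not_dvd Fact.out).1 hcop
  obtain ⟨τ, hτ⟩ := exists_isRootTower hℓk
  obtain ⟨g, hg⟩ := hτ.exists_map_one_ne
  have hS : IsProcyclicTower ℓ (fun n => MulAction.stabilizer (Inertia k) (τ n)) g :=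
    { isOpen := fun n => stabilizer_isOpen_of_isIntegral (τ n)
      normal := hτ.stabilizer_normal
      antitone := hτ.stabilizer_antitone
      exists_pow := hτ.exists_pow_inv_mul_mem hg
      dvd_of_pow_mem := hτ.dvd_of_pow_mem hg }
  obtain ⟨χ, hχ, hfin⟩ := hS.exists_twist_finite (fun h hh W hW =>
    hτ.exists_coprime_pow_mem hℓk (fun n => Subgroup.mem_iInf.1 hh n) hW) hcont hirr
  exact ⟨χ, fun h hh => hχ h (Subgroup.mem_iInf.2 fun n => hτ.wildInertia_le hcop n hh),
    finite_range_tprod_ofCharacter hfin⟩
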